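/- Let $D\subseteq\mathbb R^d$ be a centered symmetric convex body, i.e. a compact convex set with $0\in\operatorname{int}(D)$ and $D=-D$. Let $D^\circ=\{z\in\mathbb R^d:\ x\cdot z\le 1 \text{ for all } x\in D\}$ be its polar set, let $|x|_{D^\circ}=\inf\{a>0:\ x\in aD^\circ\}$, and for $\Omega\subseteq\mathbb R^d$ let $$\delta_{D^\circ}(\Omega)=\sup_{z\in\mathbb R^d}\ \inf_{\omega\in\Omega}|\omega-z|_{D^\circ}\in[0,\infty]$$ be the gap of $\Omega$ (with $\inf\emptyset=\infty$). Let $\Omega\subseteq\mathbb R^d$ be a closed countable set with $\delta:=\delta_{D^\circ}(\Omega)<1/4$. Then for every $\varepsilon>0$ such that $(1+\varepsilon)\delta<1/4$, $$|D|\,\varepsilon^{d}\cos\bigl(2\pi(1+\varepsilon)\delta\bigr)^2\,\|f\|_2^2\ \le\ \sum_{\omega\in\Omega}|\hat f(\omega)|^2\qquad\text{for all } f\in L^2(D).$$ Here $|D|$ is the Lebesgue measure of $D$, $L^2(D)$ is the subspace of the complex-valued functions in $L^2(\mathbb R^d)$ that vanish almost everywhere outside $D$, $\hat f(\xi)=\int_{\mathbb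 R^d}f(x)e^{-2\pi i\,\xi\cdot x}\,dx$, and the sum on the right takes values in $[0,\infty]$ (no separation of $\Omega$ is assumed). -/

import Mathlib

open MeasureTheory
open scoped ENNReal FourierTransform Pointwise

/-- A centered symmetric convex body in `ℝ^d`. -/
structure IsCenteredSymmetricConvexBody {d : ℕ} (D : Set (EuclideanSpace ℝ (Fin d))) : Prop where
  isCompact : IsCompact D
  convex : Convex ℝ D
  zero_mem_interior : (0 : EuclideanSpace ℝ (Fin d)) ∈ interior D
  symmetric : D = -D

/-- The polar set `D° = {z : x · z ≤ 1 for all x ∈ D}`. -/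
def polarSet {d : ℕ} (D : Set (EuclideanSpace ℝ (Fin d))) : Set (EuclideanSpace ℝ (Fin d)) :=
  {z | ∀ x ∈ D, inner ℝ x z ≤ 1}

/-- The gap `δ_K(Ω) = sup_z inf_{ω ∈ Ω} |ω - z|_K` of `Ω` with respect to the norm
`|x|_K = inf {a > 0 : x ∈ a K}` (Mathlib's `gauge`). It is `∞` if the supremum is unbounded
or if `Ω` is empty. -/
noncomputable def samplingGap {d : ℕ} (K Ω : Set (EuclideanSpace ℝ (Fin d))) : ℝ≥0∞ :=
  ⨆ z : EuclideanSpace ℝ (Fin d), ⨅ ω ∈ Ω, ENNReal.ofReal (gauge K (ω - z))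

/-- `f` represents an element of `L²(D)`, the subspace of `L²(ℝ^d)` of the functions supported
on `D` (up to null sets). -/
def MemL2On {d : ℕ} (D : Set (EuclideanSpace ℝ (Fin d))) (f : EuclideanSpace ℝ (Fin d) → ℂ) :
    Prop :=
  MemLp f 2 volume ∧ ∀ᵐ x ∂volume, x ∉ D → f x = 0

/-! Fix `x` and let `g` be the indicator of `ε • D`. The function `w ↦ 𝓕 f w * 𝓕 g (x - w)` has
spectrum in `(1 + ε) • D` and vanishes at infinity, so its modulus has a maximum point `y`. Along a
line through `y` it cannot decay faster than a cosine (`mul_cos_le_re_of_norm_le`). Hence at some `ω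
∈ Ω` with gauge distance less than `r` from `y` it is still at least `cos (2π(1 + ε)r)` times its
value at `w = x`, in modulus. Squaring, bounding by the sum over `Ω` and integrating in `x`,
Plancherel for `f` and `g` gives `|εD|² cos² ‖f‖² ≤ |εD| ∑ |𝓕 f ω|²`, and one factor `|εD| = ε^d
|D|` cancels.

The cosine bound comes from the Fourier series of `exp (iθs) - i s sin θ` on `[-1, 1]`: up to `(-1)
^ n` its coefficients are nonpositive for `n ≠ 0` and have total `cos θ`. -/

/-! ### Plancherel for the Fourier integral on L¹ ∩ L² -/

section Plancherel

variable {V : Type*} [NormedAddCommGroup V] [InnerProductSpace ℝ V] [FiniteDimensional ℝ V]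
  [MeasurableSpace V] [BorelSpace V]

theorem continuous_fourier_of_integrable {f : V → ℂ} (hf : Integrable f volume) : Continuous (𝓕 f) :=
  VectorFourier.fourierIntegral_continuous Real.continuous_fourierChar
    (innerSL ℝ).continuous₂ hf

/-- On `L¹ ∩ L²` the Fourier transform on `L²` is given by the Fourier integral. -/
theorem Lp_fourier_toLp_ae_eq {f : V → ℂ} (hf : Integrable f volume) (hf2 : MemLp f 2 volume) :
    (𝓕 (hf2.toLp f) : Lp (α := V) ℂ 2 volume) =ᵐ[volume] 𝓕 f := by
  apply ae_eq_of_integral_contDiff_smul_eq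
  · exact (Lp.memLp (𝓕 (hf2.toLp f) : Lp (α := V) ℂ 2 volume)).locallyIntegrable (by norm_num)
  · exact (continuous_fourier_of_integrable hf).locallyIntegrable
  intro g hg hgc
  have hg' : ContDiff ℝ (⊤ : ℕ∞) (fun x ↦ (g x : ℂ)) := Complex.ofRealCLM.contDiff.comp hg
  have hgc' : HasCompactSupport (fun x ↦ (g x : ℂ)) := hgc.comp_left (g := fun r : ℝ ↦ (r : ℂ)) rfl
  set G : SchwartzMap V ℂ := hgc'.toSchwartzMap hg' with hG
  have hGx : ∀ x, G x = (g x : ℂ) := fun x ↦ rfl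
  -- Distributionally the transform falls on the test function; Fubini then moves it onto `f`.
  have key := congrArg (fun T ↦ T G) (Lp.fourier_toTemperedDistribution_eq (hf2.toLp f))
  simp only [TemperedDistribution.fourier_apply, Lp.toTemperedDistribution_apply] at key
  have h1 : ∫ x, (𝓕 G) x • (hf2.toLp f) x = ∫ x, (𝓕 G) x • f x := by
    apply integral_congr_ae
    filter_upwards [hf2.coeFn_toLp] with x hx
    rw [hx]
  have h2 : ∫ x, (𝓕 G) x • f x = ∫ x, G x • 𝓕 f x := by
    simpa using! VectorFourier.integral_fourierIntegral_smul_eq_flip (L := innerₗ V)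
      Real.continuous_fourierChar continuous_inner G.integrable hf
  rw [h1, h2] at key
  simpa [hGx] using key.symm

/-- Plancherel's theorem for the Fourier integral on `L¹ ∩ L²`. -/
theorem eLpNorm_fourier_eq {f : V → ℂ} (hf : Integrable f volume) (hf2 : MemLp f 2 volume) :
    eLpNorm (𝓕 f) 2 volume = eLpNorm f 2 volume := by
  have h := Lp.norm_fourier_eq (hf2.toLp f)
  rw [Lp.norm_def, Lp.norm_def, ENNReal.toReal_eq_toReal_iff' (Lp.eLpNorm_ne_top _)
    (Lp.eLpNorm_ne_top _), eLpNorm_congr_ae (Lp_fourier_toLp_ae_eq hf hf2),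
    eLpNorm_congr_ae hf2.coeFn_toLp] at h
  exact h

theorem lintegral_enorm_fourier_sq {f : V → ℂ} (hf : Integrable f volume) (hf2 : MemLp f 2 volume) :
    ∫⁻ x, ‖(𝓕 f : V → ℂ) x‖ₑ ^ 2 = eLpNorm f 2 volume ^ 2 := by
  rw [← eLpNorm_fourier_eq hf hf2]
  simpa using (eLpNorm_nnreal_pow_eq_lintegral (μ := volume) (f := (𝓕 f : V → ℂ)) (p := 2)
    two_ne_zero).symm

end Plancherel

/-! ### A Fourier series with signed coefficients -/

section ExpansionOfExponentials

/-- The coefficients of `exp (iθs) - i s sin θ` on `[-1, 1]` with respect to `exp (iπns)`,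
up to the sign `(-1) ^ n`. -/
noncomputable def nodeWeight (θ : ℝ) (n : ℤ) : ℝ :=
  if n = 0 then Real.sin θ / θ else θ * Real.sin θ / (Real.pi * n * (θ - Real.pi * n))

/-- Rests on `n ≤ n ^ 2` for integers. It yields the sign of the weights, their quadratic decay, and
`θ ≠ πn`. -/
theorem mul_sub_pi_le {θ : ℝ} (h0 : 0 < θ) (n : ℤ) :
    Real.pi * n * (θ - Real.pi * n) ≤ -(Real.pi * (Real.pi - θ) * n ^ 2) := by
  have hp := Real.pi_pos
  have : 0 ≤ (n : ℝ) ^ 2 - n := by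
    have : 0 ≤ n ^ 2 - n := by nlinarith [Int.le_self_sq n]
    exact_mod_cast this
  nlinarith [mul_nonneg (mul_nonneg hp.le h0.le) this]

theorem nodeWeight_nonpos {θ : ℝ} (h0 : 0 < θ) (hπ : θ < Real.pi) {n : ℤ} (hn : n ≠ 0) :
    nodeWeight θ n ≤ 0 := by
  rw [nodeWeight, if_neg hn]
  refine div_nonpos_of_nonneg_of_nonpos
    (mul_nonneg h0.le (Real.sin_pos_of_pos_of_lt_pi h0 hπ).le)
    ((mul_sub_pi_le h0 n).trans ?_)
  have := mul_nonneg Real.pi_pos.le (sub_nonneg.2 hπ.le)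
  nlinarith [mul_nonneg this (sq_nonneg (n : ℝ))]

theorem summable_nodeWeight {θ : ℝ} (h0 : 0 < θ) (hπ : θ < Real.pi) :
    Summable (nodeWeight θ) := by
  have hb : Summable fun n : ℤ ↦
      θ * Real.sin θ / (Real.pi * (Real.pi - θ)) * (1 / (n : ℝ) ^ 2) :=
    (Real.summable_one_div_int_pow.2 one_lt_two).mul_left _
  refine Summable.of_norm_bounded_eventually hb ?_
  filter_upwards [(Set.finite_singleton (0 : ℤ)).compl_mem_cofinite] with n hn
  have hn : n ≠ 0 := hn
  have hn2 : 0 < (n : ℝ) ^ 2 := by positivity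
  have hs := mul_nonneg h0.le (Real.sin_pos_of_pos_of_lt_pi h0 hπ).le
  have hp := mul_pos Real.pi_pos (sub_pos.2 hπ)
  rw [Real.norm_of_nonpos (nodeWeight_nonpos h0 hπ hn), nodeWeight, if_neg hn, ← div_neg,
    div_mul_div_comm, mul_one]
  refine div_le_div_of_nonneg_left hs (mul_pos hp hn2) ?_
  linarith [mul_sub_pi_le h0 n]

theorem integral_exp_shifted {θ : ℝ} (n : ℤ) (h : θ - Real.pi * n ≠ 0) :
    ∫ x : ℝ in (-1)..1, Complex.exp (Complex.I * (θ - Real.pi * n) * x) =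
      (((-1) ^ n * (2 * Real.sin θ / (θ - Real.pi * n)) : ℝ) : ℂ) := by
  have hc : (θ : ℂ) - Real.pi * n ≠ 0 := by exact_mod_cast h
  rw [integral_exp_mul_complex (mul_ne_zero Complex.I_ne_zero hc)]
  have hs : Real.sin (θ - n * Real.pi) = (-1) ^ n * Real.sin θ := Real.sin_sub_int_mul_pi θ n
  have hs' : Complex.sin (θ - n * Real.pi) = (-1) ^ n * Complex.sin θ := by
    have := congrArg (fun r : ℝ ↦ (r : ℂ)) hs
    push_cast at this
    exact this
  have : (-1 : ℂ) ^ n * (2 * Complex.sin θ) = 2 * Complex.sin (θ - n * Real.pi) := by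
    rw [hs']; ring
  push_cast
  rw [← mul_div_assoc, this, Complex.sin]
  field_simp
  simp only [Complex.I_sq]
  ring_nf

/-- Subtracting `i s sin θ` makes the values at `s = ±1` agree, so the 2-periodic extension is
continuous. Its coefficients are summable, hence the series converges pointwise. -/
theorem hasSum_nodeWeight {θ : ℝ} (h0 : 0 < θ) (hπ : θ < Real.pi) {s : ℝ} (hs : |s| ≤ 1) :
    HasSum (fun n : ℤ ↦ (((-1) ^ n * nodeWeight θ n : ℝ) : ℂ) *
        Complex.exp (Real.pi * n * s * Complex.I))
      (Complex.exp (θ * s * Complex.I) - s * Real.sin θ * Complex.I) := by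
  have : Fact ((0 : ℝ) < 2) := ⟨two_pos⟩
  set F : ℝ → ℂ := fun s ↦ Complex.exp (Complex.I * θ * s) - s * Real.sin θ * Complex.I with hF
  set F' : ℝ → ℂ := fun s ↦
    Complex.exp (Complex.I * θ * s) * (Complex.I * θ) - Real.sin θ * Complex.I with hF'
  have hderiv : ∀ x : ℝ, HasDerivAt F (F' x) x := by
    intro x
    have h1 : HasDerivAt (fun x : ℝ ↦ Complex.I * θ * (x : ℂ)) (Complex.I * θ) x := by
      simpa using (Complex.ofRealCLM.hasDerivAt (x := x)).const_mul (Complex.I * (θ : ℂ))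
    have h2 : HasDerivAt (fun x : ℝ ↦ (x : ℂ) * Real.sin θ * Complex.I)
        (Real.sin θ * Complex.I) x := by
      simpa [mul_assoc] using
        (Complex.ofRealCLM.hasDerivAt (x := x)).mul_const ((Real.sin θ : ℂ) * Complex.I)
    exact h1.cexp.sub h2
  have hFc : Continuous F := continuous_iff_continuousAt.2 fun x ↦ (hderiv x).continuousAt
  have hF'c : Continuous F' := by fun_prop
  have hend : ∀ σ : ℝ, σ = 1 ∨ σ = -1 → F σ = Real.cos θ := by
    rintro σ (rfl | rfl)
    · simp only [hF]
      rw [show Complex.I * (θ : ℂ) * ((1 : ℝ) : ℂ) = θ * Complex.I by push_cast; ring,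
        Complex.exp_mul_I]
      push_cast; ring
    · simp only [hF]
      rw [show Complex.I * (θ : ℂ) * ((-1 : ℝ) : ℂ) = (-θ) * Complex.I by push_cast; ring,
        Complex.exp_mul_I, Complex.cos_neg, Complex.sin_neg]
      push_cast; ring
  have hper : F (-1) = F (-1 + 2) := by
    rw [hend _ (Or.inr rfl), hend _ (Or.inl (by norm_num))]
  set φ : C(AddCircle (2 : ℝ), ℂ) :=
    ⟨AddCircle.liftIco 2 (-1) F, AddCircle.liftIco_continuous hper hFc.continuousOn⟩ with hφ
  have hlin : ∫ x : ℝ in (-1)..1, F x = ((2 * (Real.sin θ / θ) : ℝ) : ℂ) := by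
    have h1 := integral_exp_shifted (θ := θ) 0 (by simpa using h0.ne')
    have h2 : ∫ x : ℝ in (-1)..1, (x : ℂ) * Real.sin θ * Complex.I = 0 := by
      simp only [mul_assoc]
      rw [intervalIntegral.integral_mul_const, intervalIntegral.integral_ofReal, integral_id]
      simp
    simp only [hF]
    rw [intervalIntegral.integral_sub
      (Continuous.intervalIntegrable (by fun_prop) _ _)
      (Continuous.intervalIntegrable (by fun_prop) _ _), h2, sub_zero]
    simpa [mul_div_assoc] using h1
  have hcoeff : ∀ n : ℤ, fourierCoeff φ n = (((-1) ^ n * nodeWeight θ n : ℝ) : ℂ) := by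
    intro n
    have h12 : (-1 : ℝ) + 2 = 1 := by norm_num
    rw [hφ, ContinuousMap.coe_mk, fourierCoeff_liftIco_eq]
    rcases eq_or_ne n 0 with rfl | hn
    · rw [fourierCoeffOn_eq_integral, h12]
      simp only [neg_zero, fourier_zero, one_smul, hlin, nodeWeight]
      push_cast
      norm_num
      ring
    have hn' : (n : ℂ) ≠ 0 := by exact_mod_cast hn
    have hp : (Real.pi : ℂ) ≠ 0 := by exact_mod_cast Real.pi_ne_zero
    have hθn : θ - Real.pi * n ≠ 0 := by
      intro h
      have h1 := mul_sub_pi_le h0 n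
      rw [h, mul_zero] at h1
      have : 0 < Real.pi * (Real.pi - θ) * (n : ℝ) ^ 2 :=
        mul_pos (mul_pos Real.pi_pos (sub_pos.2 hπ)) (by positivity)
      linarith
    have hθn' : (θ : ℂ) - Real.pi * n ≠ 0 := by exact_mod_cast hθn
    -- Integration by parts; the boundary term vanishes because both endpoint values are `cos θ`.
    rw [fourierCoeffOn_of_hasDerivAt _ hn (fun x _ ↦ hderiv x)
      (hF'c.intervalIntegrable _ _), fourierCoeffOn_eq_integral, h12, hend 1 (Or.inl rfl),
      hend (-1) (Or.inr rfl)]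
    have hint : ∫ x : ℝ in (-1)..1, (fourier (-n)) (x : AddCircle ((1 : ℝ) - -1)) • F' x =
        Complex.I * θ * (((-1) ^ n * (2 * Real.sin θ / (θ - Real.pi * n)) : ℝ) : ℂ) := by
      have h1 := integral_exp_shifted (θ := θ) n hθn
      have h2 := integral_exp_shifted (θ := 0) n
        (by simp [hn])
      rw [← h1, ← intervalIntegral.integral_const_mul]
      -- The constant part of `F'` does not contribute when `n ≠ 0`.
      have h3 : ∫ x : ℝ in (-1)..1, (Real.sin θ : ℂ) * Complex.I *
          Complex.exp (Complex.I * ((0 : ℝ) - Real.pi * n) * x) = 0 := by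
        rw [intervalIntegral.integral_const_mul, h2]
        simp
      rw [← sub_zero (∫ x : ℝ in (-1)..1, Complex.I * θ * _), ← h3,
        ← intervalIntegral.integral_sub
          (Continuous.intervalIntegrable (by fun_prop) _ _)
          (Continuous.intervalIntegrable (by fun_prop) _ _)]
      refine intervalIntegral.integral_congr fun x _ ↦ ?_
      simp only [hF', fourier_coe_apply, smul_eq_mul, mul_sub]
      congr 1
      · rw [← mul_assoc, ← Complex.exp_add, mul_comm]
        congr 2
        push_cast
        ring
      · rw [mul_comm]
        congr 2
        push_cast
        ring
    rw [hint, nodeWeight, if_neg hn]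
    simp only [Complex.real_smul]
    push_cast
    field_simp
    norm_num
  have hsum : Summable (fourierCoeff φ) := by
    rw [funext hcoeff]
    refine Complex.ofRealCLM.summable (Summable.of_norm ?_)
    refine (summable_nodeWeight h0 hπ).norm.congr fun n ↦ ?_
    change _ = ‖(-1 : ℝ) ^ n * nodeWeight θ n‖
    rw [norm_mul, norm_zpow, norm_neg, norm_one, one_zpow, one_mul]
  have hφs : φ (s : AddCircle (2 : ℝ)) = F s := by
    rcases (abs_le.1 hs).2.eq_or_lt with rfl | h1
    · have : ((1 : ℝ) : AddCircle (2 : ℝ)) = ((-1 : ℝ) : AddCircle (2 : ℝ)) := by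
        rw [← AddCircle.coe_add_period (2 : ℝ) (-1)]
        norm_num
      rw [this, hφ, ContinuousMap.coe_mk, AddCircle.liftIco_coe_apply (by norm_num),
        hend _ (Or.inl rfl), hend _ (Or.inr rfl)]
    · rw [hφ, ContinuousMap.coe_mk, AddCircle.liftIco_coe_apply]
      exact ⟨(abs_le.1 hs).1, by linarith⟩
  have := has_pointwise_sum_fourier_series_of_summable hsum (s : AddCircle (2 : ℝ))
  rw [hφs] at this
  convert! this using 1
  · ext n
    rw [hcoeff, fourier_coe_apply, smul_eq_mul]
    congr 2
    push_cast
    ring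
  · simp only [hF]
    congr 2
    ring

end ExpansionOfExponentials

/-! ### Band-limited functions near a maximum of the modulus -/

section BandlimitedMaximum

variable {X : Type*} [MeasurableSpace X] {ν : Measure X} {h : X → ℂ} {s : X → ℝ}

theorem hasDerivAt_integral_mul_cexp_zero (hh : Integrable h ν) (hs : Measurable s)
    (hbd : ∀ p, h p ≠ 0 → |s p| ≤ 1) :
    HasDerivAt (fun τ : ℝ ↦ ∫ p, h p * Complex.exp (τ * s p * Complex.I) ∂ν)
      (∫ p, h p * (s p * Complex.I) ∂ν) 0 := by
  have hms : Measurable fun p ↦ (s p : ℂ) := Complex.measurable_ofReal.comp hs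
  have key := hasDerivAt_integral_of_dominated_loc_of_deriv_le (μ := ν) (x₀ := (0 : ℝ))
    (s := Set.univ) (bound := fun p ↦ ‖h p‖)
    (F := fun (τ : ℝ) p ↦ h p * Complex.exp (τ * s p * Complex.I))
    (F' := fun τ p ↦ h p * (Complex.exp (τ * s p * Complex.I) * (s p * Complex.I)))
    Filter.univ_mem (Filter.Eventually.of_forall fun τ ↦ hh.1.mul (by fun_prop))
    (by simpa using hh) (hh.1.mul (by fun_prop)) (Filter.Eventually.of_forall ?_) hh.norm
    (Filter.Eventually.of_forall ?_)
  · simpa using key.2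
  · intro p τ _
    rcases eq_or_ne (h p) 0 with h0 | h0
    · simp [h0]
    have he : ‖Complex.exp (τ * s p * Complex.I)‖ = 1 := by
      exact_mod_cast Complex.norm_exp_ofReal_mul_I (τ * s p)
    rw [norm_mul, norm_mul, norm_mul, he, Complex.norm_I, Complex.norm_real, one_mul, mul_one,
      Real.norm_eq_abs]
    exact mul_le_of_le_one_right (norm_nonneg _) (hbd p h0)
  · intro p τ _
    have h1 : HasDerivAt (fun τ : ℝ ↦ (τ : ℂ) * s p * Complex.I) (s p * Complex.I) τ := by
      simpa [mul_assoc] using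
        (Complex.ofRealCLM.hasDerivAt (x := τ)).mul_const ((s p : ℂ) * Complex.I)
    exact h1.cexp.const_mul (h p)

/-- If a function with spectrum in `[-1, 1]` attains the maximum `M` of its modulus at the origin,
then its real part stays above `M cos θ` on `[0, π)`. -/
theorem mul_cos_le_re_of_norm_le (hh : Integrable h ν) (hs : Measurable s)
    (hbd : ∀ p, h p ≠ 0 → |s p| ≤ 1) {M : ℝ}
    (hM : ∀ τ : ℝ, ‖∫ p, h p * Complex.exp (τ * s p * Complex.I) ∂ν‖ ≤ M)
    (h0 : ∫ p, h p ∂ν = M) {θ : ℝ} (hθ : 0 < θ) (hθπ : θ < Real.pi) :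
    M * Real.cos θ ≤ (∫ p, h p * Complex.exp (θ * s p * Complex.I) ∂ν).re := by
  set G : ℝ → ℂ := fun τ ↦ ∫ p, h p * Complex.exp (τ * s p * Complex.I) ∂ν with hG
  have hms : Measurable fun p ↦ (s p : ℂ) := Complex.measurable_ofReal.comp hs
  have hG0 : G 0 = M := by simp [hG, h0]
  have hint : ∀ τ : ℝ, Integrable (fun p ↦ h p * Complex.exp (τ * s p * Complex.I)) ν := by
    intro τ
    refine hh.mul_bdd (c := 1) (by fun_prop) (Filter.Eventually.of_forall fun p ↦ ?_)
    exact_mod_cast (Complex.norm_exp_ofReal_mul_I (τ * s p)).le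
  have hlin : Integrable (fun p ↦ h p * (s p * Complex.I)) ν := by
    refine hh.mono (hh.1.mul (by fun_prop)) (Filter.Eventually.of_forall fun p ↦ ?_)
    rcases eq_or_ne (h p) 0 with h0 | h0
    · simp [h0]
    rw [norm_mul, norm_mul, Complex.norm_I, Complex.norm_real, mul_one, Real.norm_eq_abs]
    exact mul_le_of_le_one_right (norm_nonneg _) (hbd p h0)
  -- `Re G ≤ |G| ≤ M = G 0`, so `Re G` is maximal at the origin.
  have hderiv : (∫ p, h p * (s p * Complex.I) ∂ν).re = 0 := by
    have h1 : HasDerivAt (fun τ ↦ (G τ).re) (∫ p, h p * (s p * Complex.I) ∂ν).re 0 :=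
      Complex.reCLM.hasFDerivAt.comp_hasDerivAt (0 : ℝ)
        (hasDerivAt_integral_mul_cexp_zero hh hs hbd)
    refine IsLocalMax.hasDerivAt_eq_zero (Filter.Eventually.of_forall fun τ ↦ ?_) h1
    simpa [hG0] using (Complex.re_le_norm _).trans (hM τ)
  have hw := summable_nodeWeight hθ hθπ
  have hsum : HasSum (fun n : ℤ ↦ (((-1) ^ n * nodeWeight θ n : ℝ) : ℂ) * G (Real.pi * n))
      (G θ - Real.sin θ * ∫ p, h p * (s p * Complex.I) ∂ν) := by
    have := hasSum_integral_of_dominated_convergence (μ := ν)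
      (F := fun (n : ℤ) p ↦ (((-1) ^ n * nodeWeight θ n : ℝ) : ℂ) *
        (h p * Complex.exp ((Real.pi * n : ℝ) * s p * Complex.I)))
      (f := fun p ↦ h p * Complex.exp (θ * s p * Complex.I) -
        Real.sin θ * (h p * (s p * Complex.I)))
      (fun n p ↦ |nodeWeight θ n| * ‖h p‖) (fun n ↦ ((hint _).const_mul _).1) ?_
      (Filter.Eventually.of_forall fun p ↦ hw.abs.mul_right _) ?_ ?_
    · rw [integral_sub (hint θ) (hlin.const_mul _), integral_const_mul] at this
      simpa only [integral_const_mul] using this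
    · refine fun n ↦ Filter.Eventually.of_forall fun p ↦ ?_
      have he : ‖Complex.exp ((Real.pi * n : ℝ) * s p * Complex.I)‖ = 1 := by
        exact_mod_cast Complex.norm_exp_ofReal_mul_I (Real.pi * n * s p)
      rw [norm_mul, norm_mul, he, Complex.norm_real, norm_mul, norm_zpow, norm_neg, norm_one,
        one_zpow, one_mul, mul_one, Real.norm_eq_abs]
    · simp only [tsum_mul_right]
      exact hh.norm.const_mul _
    · refine Filter.Eventually.of_forall fun p ↦ ?_
      rcases eq_or_ne (h p) 0 with h0 | h0
      · simp [h0]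
      convert! (hasSum_nodeWeight hθ hθπ (hbd p h0)).mul_left (h p) using 1
      · ext n
        push_cast
        ring
      · ring
  -- The expansion at `s = 1`, where the signs `(-1) ^ n` cancel.
  have hcos : HasSum (fun n : ℤ ↦ nodeWeight θ n) (Real.cos θ) := by
    have h1 := Complex.reCLM.hasSum (hasSum_nodeWeight hθ hθπ (s := 1) (by simp))
    convert! h1 using 1
    · ext n
      have : Complex.exp (Real.pi * n * (1 : ℝ) * Complex.I) = (((-1) ^ n : ℝ) : ℂ) := by
        rw [show (Real.pi * n * (1 : ℝ) * Complex.I : ℂ) = n * (Real.pi * Complex.I) by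
          push_cast; ring, Complex.exp_int_mul, Complex.exp_pi_mul_I]
        push_cast
        rfl
      rw [this, ← Complex.ofReal_mul, Complex.reCLM_apply, Complex.ofReal_re,
        mul_right_comm, ← mul_zpow]
      simp
    · simp [Complex.exp_re]
  have hre := Complex.reCLM.hasSum hsum
  have hval : Complex.reCLM (G θ - Real.sin θ * ∫ p, h p * (s p * Complex.I) ∂ν) = (G θ).re := by
    rw [Complex.reCLM_apply, Complex.sub_re, Complex.re_ofReal_mul, hderiv, mul_zero, sub_zero]
  rw [hval] at hre
  refine hasSum_le (fun n ↦ ?_) (hcos.mul_left M) hre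
  rw [Complex.reCLM_apply, Complex.re_ofReal_mul]
  rcases eq_or_ne n 0 with rfl | hn
  · simp [hG0, mul_comm]
  have hw0 := nodeWeight_nonpos hθ hθπ hn
  have hle : |(-1) ^ n * (G (Real.pi * n)).re| ≤ M := by
    rw [abs_mul, abs_zpow, abs_neg, abs_one, one_zpow, one_mul]
    exact (Complex.abs_re_le_norm _).trans (hM _)
  nlinarith [mul_nonneg (neg_nonneg.2 hw0) (sub_nonneg.2 (abs_le.1 hle).2)]

end BandlimitedMaximum

/-! ### Products of Fourier transforms -/

section ProductOfTransforms

variable {V : Type*} [NormedAddCommGroup V] [InnerProductSpace ℝ V] [FiniteDimensional ℝ V]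
  [MeasurableSpace V] [BorelSpace V]

theorem norm_mul_cos_le_of_isMax {f g : V → ℂ} (hf : Integrable f volume)
    (hg : Integrable g volume) {y z v : V} {a b : ℝ}
    (hfa : ∀ p, f p ≠ 0 → |inner ℝ p v| ≤ a) (hgb : ∀ p, g p ≠ 0 → |inner ℝ p v| ≤ b)
    (hab : 0 < a + b) (hab' : 2 * (a + b) < 1)
    (hmax : ∀ w, ‖𝓕 f (y + w) * 𝓕 g (z - w)‖ ≤ ‖𝓕 f y * 𝓕 g z‖) :
    ‖𝓕 f y * 𝓕 g z‖ * Real.cos (2 * Real.pi * (a + b)) ≤ ‖𝓕 f (y + v) * 𝓕 g (z - v)‖ := by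
  -- The unimodular `c` rotates the maximal value onto the positive axis.
  obtain ⟨c, hc, hcA⟩ := RCLike.exists_norm_eq_mul_self (𝓕 f y * 𝓕 g z)
  set r := a + b
  have hπ := Real.pi_pos
  set φ : V → ℂ := fun p ↦ Real.fourierChar (-inner ℝ p y) • f p
  set ψ : V → ℂ := fun p ↦ Real.fourierChar (-inner ℝ p z) • g p
  have hφ : Integrable φ volume := (Real.fourierIntegral_convergent_iff y).2 hf
  have hψ : Integrable ψ volume := (Real.fourierIntegral_convergent_iff z).2 hg
  set h : V × V → ℂ := fun p ↦ c * (φ p.1 * ψ p.2)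
  -- Frequency in direction `v`, scaled into `[-1, 1]`; the point `y + v` is then reached at `τ =
  -- 2πr`.
  set s : V × V → ℝ := fun p ↦ (inner ℝ p.2 v - inner ℝ p.1 v) / r
  have hh : Integrable h (volume.prod volume) := (hφ.mul_prod hψ).const_mul c
  have hs : Measurable s := by fun_prop
  have hG : ∀ τ : ℝ, ∫ p, h p * Complex.exp (τ * s p * Complex.I) ∂(volume.prod volume) =
      c * (𝓕 f (y + (τ / (2 * Real.pi * r)) • v) * 𝓕 g (z - (τ / (2 * Real.pi * r)) • v)) := by
    intro τ
    rw [Real.fourier_eq, Real.fourier_eq, ← integral_prod_mul, ← integral_const_mul]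
    congr 1
    ext p
    simp only [h, φ, ψ, s, Circle.smul_def, Real.fourierChar_apply, smul_eq_mul, inner_add_right,
      inner_sub_right, inner_smul_right]
    have : ∀ A B C A' B' F G : ℂ, A * B * C = A' * B' →
        c * ((A * F) * (B * G)) * C = c * ((A' * F) * (B' * G)) := by
      intro A B C A' B' F G e
      linear_combination c * F * G * e
    apply this
    rw [← Complex.exp_add, ← Complex.exp_add, ← Complex.exp_add]
    congr 1
    have hr : (r : ℂ) ≠ 0 := by exact_mod_cast hab.ne'
    have hp : (Real.pi : ℂ) ≠ 0 := by exact_mod_cast hπ.ne'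
    push_cast
    field_simp
    ring
  have hbd : ∀ p, h p ≠ 0 → |s p| ≤ 1 := by
    intro p hp
    have h1 : f p.1 ≠ 0 := fun h0 ↦ hp (by simp [h, φ, h0])
    have h2 : g p.2 ≠ 0 := fun h0 ↦ hp (by simp [h, ψ, h0])
    rw [abs_div, abs_of_pos hab, div_le_one hab]
    linarith [abs_sub (inner ℝ p.2 v) (inner ℝ p.1 v), hfa _ h1, hgb _ h2]
  have key := mul_cos_le_re_of_norm_le hh hs hbd (M := ‖𝓕 f y * 𝓕 g z‖)
    (fun τ ↦ by rw [hG, norm_mul, hc, one_mul]; exact hmax _)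
    (by simpa using (hG 0).trans (by simpa using hcA.symm))
    (θ := 2 * Real.pi * r) (by positivity) (by nlinarith)
  refine key.trans ((Complex.re_le_norm _).trans ?_)
  rw [hG, norm_mul, hc, one_mul, div_self (by positivity), one_smul]

/-- By Riemann–Lebesgue for `f` and boundedness of `𝓕 g`, the product tends to zero at infinity. -/
theorem exists_isMax_norm_fourier_mul_fourier {f g : V → ℂ} (hf : Integrable f volume)
    (hg : Integrable g volume) (x : V) :
    ∃ y, ∀ w, ‖𝓕 f w * 𝓕 g (x - w)‖ ≤ ‖𝓕 f y * 𝓕 g (x - y)‖ := by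
  have hcf := continuous_fourier_of_integrable hf
  have hcg := continuous_fourier_of_integrable hg
  have hc : Continuous fun w ↦ ‖𝓕 f w * 𝓕 g (x - w)‖ := by fun_prop
  by_cases hall : ∃ w, 𝓕 f w * 𝓕 g (x - w) ≠ 0
  · obtain ⟨y, hy⟩ := hall
    refine hc.exists_forall_ge' y ?_
    have hlim : Filter.Tendsto (fun w ↦ ‖𝓕 f w * 𝓕 g (x - w)‖) (Filter.cocompact V) (nhds 0) := by
      rw [← norm_zero (E := ℂ)]
      refine Filter.Tendsto.norm (Filter.Tendsto.zero_mul_isBoundedUnder_le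
        (tendsto_integral_exp_inner_smul_cocompact f) ?_)
      exact Filter.isBoundedUnder_of ⟨∫ p, ‖g p‖, fun w ↦
        VectorFourier.norm_fourierIntegral_le_integral_norm _ _ _ _ _⟩
    filter_upwards [hlim.eventually_lt_const (norm_pos_iff.2 hy)] with w hw using hw.le
  · push Not at hall
    exact ⟨x, fun w ↦ by rw [hall, norm_zero]; exact norm_nonneg _⟩

end ProductOfTransforms

/-! ### Polar gauge and gap -/

section Gauge

variable {d : ℕ} {D : Set (EuclideanSpace ℝ (Fin d))}

theorem abs_inner_le_of_gauge_polarSet_lt (hD : IsCenteredSymmetricConvexBody D)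
    {v x : EuclideanSpace ℝ (Fin d)} {r : ℝ} (hr : gauge (polarSet D) v < r) (hx : x ∈ D) :
    |inner ℝ x v| ≤ r := by
  obtain ⟨R, hR0, hR⟩ := hD.isCompact.isBounded.exists_pos_norm_le
  have hmem : ∀ {a : ℝ}, 0 < a → v ∈ a • polarSet D → |inner ℝ x v| ≤ a := by
    intro a ha hv
    obtain ⟨w, hw, rfl⟩ := Set.mem_smul_set.1 hv
    have h1 := hw x hx
    have h2 := hw (-x) (by rw [hD.symmetric]; simpa using hx)
    rw [inner_neg_left] at h2
    rw [inner_smul_right, abs_mul, abs_of_pos ha]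
    exact mul_le_of_le_one_right ha.le (abs_le.2 ⟨by linarith, h1⟩)
  -- Boundedness of `D` keeps the gauge from being the default infimum `0` of an empty set.
  have hne : {a : ℝ | 0 < a ∧ v ∈ a • polarSet D}.Nonempty := by
    have ha : 0 < R * ‖v‖ + 1 := by positivity
    refine ⟨R * ‖v‖ + 1, ha, ?_⟩
    rw [Set.mem_smul_set_iff_inv_smul_mem₀ ha.ne']
    intro p hp
    rw [inner_smul_right, inv_mul_le_one₀ ha]
    have := mul_le_mul_of_nonneg_right (hR p hp) (norm_nonneg v)
    linarith [real_inner_le_norm p v]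
  obtain ⟨a, ⟨ha, hva⟩, har⟩ := exists_lt_of_csInf_lt hne hr
  exact (hmem ha hva).trans har.le

theorem exists_gauge_sub_lt_of_samplingGap_lt {K Ω : Set (EuclideanSpace ℝ (Fin d))} {r : ℝ}
    (hgap : samplingGap K Ω < ENNReal.ofReal r) (z : EuclideanSpace ℝ (Fin d)) :
    ∃ ω ∈ Ω, gauge K (ω - z) < r := by
  have h := (le_iSup (fun z ↦ ⨅ ω ∈ Ω, ENNReal.ofReal (gauge K (ω - z))) z).trans_lt hgap
  simp only [iInf_lt_iff] at h
  obtain ⟨ω, hω, h⟩ := h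
  exact ⟨ω, hω, (ENNReal.ofReal_lt_ofReal_iff_of_nonneg (gauge_nonneg _)).1 h⟩

end Gauge

/-! ### The sampling inequality -/

section Sampling

variable {d : ℕ} {D Ω : Set (EuclideanSpace ℝ (Fin d))}

theorem integrable_of_memL2On (hD : IsCompact D) {f : EuclideanSpace ℝ (Fin d) → ℂ}
    (hf : MemL2On D f) : Integrable f volume := by
  have h1 : IntegrableOn f D volume := by
    have : IsFiniteMeasure (volume.restrict D) := ⟨by simpa using hD.measure_lt_top⟩
    exact (hf.1.restrict D).integrable one_le_two
  exact h1.integrable_of_ae_notMem_eq_zero hf.2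

/-- The pointwise estimate behind the sampling inequality: multiplying by a transform with
spectrum in `ε D` turns the supremum norm bound for spectra in `(1 + ε) D` into a bound by a
square sum. -/
theorem norm_fourier_mul_cos_le_of_samplingGap_lt (hD : IsCenteredSymmetricConvexBody D)
    {ε r : ℝ} (hε : 0 < ε) (hr : 0 < r) (hεr : (1 + ε) * r < 1 / 4)
    (hgap : samplingGap (polarSet D) Ω < ENNReal.ofReal r)
    {f g : EuclideanSpace ℝ (Fin d) → ℂ} (hf : Integrable f volume) (hg : Integrable g volume)
    (hfD : ∀ x, f x ≠ 0 → x ∈ D) (hgD : ∀ x, g x ≠ 0 → x ∈ ε • D)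
    (x : EuclideanSpace ℝ (Fin d)) :
    ∃ ω ∈ Ω, ‖𝓕 f x * 𝓕 g 0‖ * Real.cos (2 * Real.pi * (1 + ε) * r) ≤
      ‖𝓕 f ω * 𝓕 g (x - ω)‖ := by
  obtain ⟨y, hy⟩ := exists_isMax_norm_fourier_mul_fourier hf hg x
  obtain ⟨ω, hω, hωy⟩ := exists_gauge_sub_lt_of_samplingGap_lt hgap y
  refine ⟨ω, hω, ?_⟩
  have hcos : 0 ≤ Real.cos (2 * Real.pi * (1 + ε) * r) := by
    have hπ := Real.pi_pos
    have h0 : 0 < (1 + ε) * r := by positivity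
    apply Real.cos_nonneg_of_mem_Icc
    constructor <;> nlinarith
  have key := norm_mul_cos_le_of_isMax hf hg (y := y) (z := x - y) (v := ω - y) (a := r)
    (b := ε * r) (fun p hp ↦ abs_inner_le_of_gauge_polarSet_lt hD hωy (hfD p hp))
    (fun p hp ↦ by
      obtain ⟨q, hq, rfl⟩ := Set.mem_smul_set.1 (hgD p hp)
      rw [real_inner_smul_left, abs_mul, abs_of_pos hε]
      exact mul_le_mul_of_nonneg_left (abs_inner_le_of_gauge_polarSet_lt hD hωy hq) hε.le)
    (by positivity) (by linarith)
    (fun w ↦ by simpa [sub_sub] using hy (y + w))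
  rw [show 2 * Real.pi * (r + ε * r) = 2 * Real.pi * (1 + ε) * r by ring, add_sub_cancel,
    sub_sub_sub_cancel_right] at key
  refine (mul_le_mul_of_nonneg_right ?_ hcos).trans key
  simpa using hy x

theorem sampling_lower_bound_of_samplingGap_lt (hD : IsCenteredSymmetricConvexBody D)
    (hΩ : Ω.Countable) {ε r : ℝ} (hε : 0 < ε) (hr : 0 < r) (hεr : (1 + ε) * r < 1 / 4)
    (hgap : samplingGap (polarSet D) Ω < ENNReal.ofReal r)
    {f : EuclideanSpace ℝ (Fin d) → ℂ} (hf : MemL2On D f) :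
    volume D * ENNReal.ofReal (ε ^ d * Real.cos (2 * Real.pi * (1 + ε) * r) ^ 2) *
        eLpNorm f 2 volume ^ 2
      ≤ ∑' ω : Ω, ‖𝓕 f (ω : EuclideanSpace ℝ (Fin d))‖ₑ ^ 2 := by
  have hcount : Countable Ω := hΩ.to_subtype
  have hfi := integrable_of_memL2On hD.isCompact hf
  -- This representative vanishes everywhere off `D`, as the pointwise estimate requires.
  set f₀ := D.indicator f with hf₀
  have hae : f₀ =ᵐ[volume] f := by
    filter_upwards [hf.2] with x hx
    by_cases hxD : x ∈ D
    · simp [hf₀, hxD]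
    · simp [hf₀, hxD, hx hxD]
  have hfF : 𝓕 f₀ = 𝓕 f := funext fun x ↦ Real.fourier_congr_ae hae x
  have hεD : IsCompact (ε • D) := hD.isCompact.smul ε
  have hvol : volume (ε • D) = ENNReal.ofReal (ε ^ d) * volume D := by
    rw [Measure.addHaar_smul, finrank_euclideanSpace_fin, abs_of_pos (by positivity)]
  have hvt : volume (ε • D) ≠ ∞ := hεD.measure_lt_top.ne
  have hv0 : volume (ε • D) ≠ 0 := by
    have : volume D ≠ 0 := fun h ↦ (Measure.measure_pos_of_mem_nhds volume
      (mem_interior_iff_mem_nhds.1 hD.zero_mem_interior)).ne' h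
    rw [hvol]
    exact mul_ne_zero (by simpa using pow_pos hε d) this
  set g : EuclideanSpace ℝ (Fin d) → ℂ := (ε • D).indicator fun _ ↦ 1 with hg
  have hgi : Integrable g volume :=
    (integrable_indicator_iff hεD.measurableSet).2 (integrableOn_const hvt)
  have hg2 : MemLp g 2 volume := memLp_indicator_const 2 hεD.measurableSet 1 (Or.inr hvt)
  have hgnorm : eLpNorm g 2 volume ^ 2 = volume (ε • D) := by
    rw [hg, eLpNorm_indicator_const hεD.measurableSet two_ne_zero ENNReal.ofNat_ne_top,
      enorm_one, one_mul, ← ENNReal.rpow_natCast, ← ENNReal.rpow_mul]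
    norm_num
  have hg0 : ‖𝓕 g 0‖ₑ = volume (ε • D) := by
    have : 𝓕 g 0 = (volume.real (ε • D) : ℂ) := by
      rw [Real.fourier_eq]
      simp only [inner_zero_right, neg_zero, AddChar.map_zero_eq_one, one_smul, hg]
      rw [integral_indicator hεD.measurableSet]
      simp
    rw [this, ← ofReal_norm, Complex.norm_real, Real.norm_of_nonneg measureReal_nonneg,
      ofReal_measureReal hvt]
  set κ := ENNReal.ofReal (Real.cos (2 * Real.pi * (1 + ε) * r) ^ 2) with hκ
  have hpt : ∀ x, ‖𝓕 f x‖ₑ ^ 2 * (volume (ε • D) ^ 2 * κ) ≤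
      ∑' ω : Ω, ‖𝓕 f (ω : EuclideanSpace ℝ (Fin d))‖ₑ ^ 2 *
        ‖𝓕 g (x - (ω : EuclideanSpace ℝ (Fin d)))‖ₑ ^ 2 := by
    intro x
    obtain ⟨ω, hω, h⟩ := norm_fourier_mul_cos_le_of_samplingGap_lt hD hε hr hεr hgap
      (hfi.congr hae.symm) hgi (fun x hx ↦ Set.mem_of_indicator_ne_zero hx)
      (fun x hx ↦ Set.mem_of_indicator_ne_zero hx) x
    rw [hfF] at h
    -- The point `ω` depends on `x`; the full sum dominates every choice.
    refine le_trans ?_ (ENNReal.le_tsum (⟨ω, hω⟩ : Ω))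
    have hcos : 0 ≤ Real.cos (2 * Real.pi * (1 + ε) * r) := by
      have hπ := Real.pi_pos
      have h0 : 0 < (1 + ε) * r := by positivity
      apply Real.cos_nonneg_of_mem_Icc
      constructor <;> nlinarith
    have h2 := pow_le_pow_left' (ENNReal.ofReal_le_ofReal h) 2
    rw [ENNReal.ofReal_mul (norm_nonneg _), ofReal_norm, ofReal_norm, enorm_mul, enorm_mul, hg0,
      mul_pow, mul_pow, mul_pow, ← ENNReal.ofReal_pow hcos, mul_assoc] at h2
    exact h2
  have hmg : Measurable fun x ↦ ‖𝓕 g x‖ₑ ^ 2 :=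
    (continuous_fourier_of_integrable hgi).enorm.measurable.pow_const 2
  have hmf : Measurable fun x ↦ ‖𝓕 f x‖ₑ ^ 2 :=
    (continuous_fourier_of_integrable hfi).enorm.measurable.pow_const 2
  have hmg' : ∀ ω : Ω, Measurable fun x ↦ ‖𝓕 f (ω : EuclideanSpace ℝ (Fin d))‖ₑ ^ 2 *
      ‖𝓕 g (x - (ω : EuclideanSpace ℝ (Fin d)))‖ₑ ^ 2 := fun ω ↦
    (hmg.comp (measurable_sub_const _)).const_mul _
  have hint := lintegral_mono (μ := volume) hpt
  rw [lintegral_mul_const _ hmf, lintegral_enorm_fourier_sq hfi hf.1,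
    lintegral_tsum fun ω ↦ (hmg' ω).aemeasurable] at hint
  have htr : ∀ ω : Ω, ∫⁻ x, ‖𝓕 f (ω : EuclideanSpace ℝ (Fin d))‖ₑ ^ 2 *
      ‖𝓕 g (x - (ω : EuclideanSpace ℝ (Fin d)))‖ₑ ^ 2 =
      ‖𝓕 f (ω : EuclideanSpace ℝ (Fin d))‖ₑ ^ 2 * volume (ε • D) := by
    intro ω
    rw [lintegral_const_mul _ (by exact hmg.comp (measurable_sub_const _)),
      lintegral_sub_right_eq_self (fun x ↦ ‖𝓕 g x‖ₑ ^ 2), lintegral_enorm_fourier_sq hgi hg2,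
      hgnorm]
  simp only [htr] at hint
  rw [ENNReal.tsum_mul_right] at hint
  rw [← ENNReal.mul_le_mul_iff_left hv0 hvt]
  refine le_trans (le_of_eq ?_) hint
  rw [ENNReal.ofReal_mul (by positivity), ← hκ, hvol]
  ring

end Sampling

theorem corollary5p5 {d : ℕ} (D Ω : Set (EuclideanSpace ℝ (Fin d)))
    (hD : IsCenteredSymmetricConvexBody D)
    (hΩ_closed : IsClosed Ω) (hΩ_countable : Ω.Countable)
    (hgap : samplingGap (polarSet D) Ω < 1 / 4)
    (ε : ℝ) (hε : 0 < ε)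
    (hε_gap : (1 + ε) * (samplingGap (polarSet D) Ω).toReal < 1 / 4)
    (f : EuclideanSpace ℝ (Fin d) → ℂ) (hf : MemL2On D f) :
    volume D *
        ENNReal.ofReal (ε ^ d *
          Real.cos (2 * Real.pi * (1 + ε) * (samplingGap (polarSet D) Ω).toReal) ^ 2) *
        eLpNorm f 2 volume ^ 2
      ≤ ∑' ω : Ω, ‖𝓕 f (ω : EuclideanSpace ℝ (Fin d))‖ₑ ^ 2 := by
  set δ := (samplingGap (polarSet D) Ω).toReal with hδ
  have hcont : Continuous fun r : ℝ ↦
      ENNReal.ofReal (ε ^ d * Real.cos (2 * Real.pi * (1 + ε) * r) ^ 2) :=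
    ENNReal.continuous_ofReal.comp (by fun_prop)
  have hlim := ENNReal.Tendsto.mul_const (b := eLpNorm f 2 volume ^ 2)
    (ENNReal.Tendsto.const_mul (a := volume D)
      ((hcont.tendsto δ).mono_left (nhdsWithin_le_nhds (s := Set.Ioi δ)))
      (Or.inr hD.isCompact.measure_lt_top.ne))
    (Or.inr (ENNReal.pow_ne_top hf.1.2.ne))
  -- Taking `r` strictly above the gap provides a near-optimal `ω` and `r > 0`; continuity in `r`
  -- recovers the gap itself.
  refine le_of_tendsto hlim ?_
  have hδ' : δ < 1 / 4 / (1 + ε) := by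
    rw [lt_div_iff₀ (by positivity), mul_comm]
    exact hε_gap
  filter_upwards [Ioo_mem_nhdsGT hδ'] with r hr
  have hr0 : 0 < r := ENNReal.toReal_nonneg.trans_lt hr.1
  refine sampling_lower_bound_of_samplingGap_lt hD hΩ_countable hε hr0 ?_ ?_ hf
  · have := (lt_div_iff₀ (by positivity)).1 hr.2
    linarith
  · exact (ENNReal.lt_ofReal_iff_toReal_lt (hgap.trans_le le_top).ne).2 hr.1
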